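/- Let $\mathcal{P}_3$ denote the set of integer partitions in which parts divisible by $3$ may appear in two kinds, ordinary ($3,6,9,\dots$) and primed ($3',6',9',\dots$); parts not divisible by $3$ appear in one kind only. Write a partition in $\mathcal P_3$ as $\lambda_1\ge\lambda_2\ge\cdots$, and let the residue modulo $3$ of a part be $1$, $2$, $0$ (ordinary multiple of $3$) or $0'$ (primed multiple of $3$). For $n,k,m\ge 0$ let $A_3(n;k,m)$ be the number of partitions of $n$ in $\mathcal P_3$ with exactly $k$ parts congruent to $2$ and exactly $m$ parts congruent to $1$ modulo $3$, such that no part equals $1$ and for all consecutive parts $\lambda_i,\lambda_{i+1}$: (i) $\lambda_i-\lambda_{i+1}\ge 3$ if $\lambda_i$ has residue in $\{0,2\}$ and $\lambda_{i+1}$ has residue in $\{0',2\}$, or if $\lambda_i$ has residue in $\{0',1\}$ and $\lambda_{i+1}$ has residue in $\{0,1\}$; (ii) $\lambda_i-\lambda_{i+1}\ge 4$ if neither $\lambda_i$ nor $\lambda_{i+1}$ is divisible by $3$ and $\lambda_i-\lambda_{i+1}\not\equiv 2\pmod 3$. Then, as formal power series, with $(z;w)_\infty=\prod_{j\ge0}(1-zw^j)$,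 $$\sum_{n,k,m\ge 0}A_3(n;k,m)\,q^n a^k d^m=\frac{(-aq^2;q^6)_\infty(-dq^4;q^6)_\infty(-q^3;q^3)_\infty}{(q^3;q^3)_\infty}.$$ In other words, let $B_3(n;k,m)$ be the number of partitions of $n$ in $\mathcal P_3$ in which every part not divisible by $3$ is congruent to $2$ or $4$ modulo $6$, parts not divisible by $3$ are distinct, and no primed multiple of $3$ is repeated (ordinary multiples of $3$ may repeat), with exactly $k$ parts congruent to $2$ and exactly $m$ parts congruent to $4$ modulo $6$. Then $$A_3(n;k,m)=B_3(n;k,m)\qquad\text{for all } n,k,m\ge 0.$$ -/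

import Mathlib

/-- A part of a partition in which multiples of 3 come in two kinds, ordinary and primed: a positive
integer together with a mark `primed`, which only a multiple of 3 may carry. -/
@[ext]
structure P3Part where
  size : ℕ
  primed : Bool
  pos : 0 < size
  dvd_of_primed : primed = true → 3 ∣ size

/-- Residues modulo 3, the residue 0 being `zero` for ordinary and `zeroPrimed` for primed parts. -/
inductive P3Residue where
  | zero
  | zeroPrimed
  | one
  | two

/-- The residue modulo 3 of a part, remembering its kind. -/
def P3Part.residue (x : P3Part) : P3Residue :=
  if x.primed = true then P3Residue.zeroPrimed
  else if x.size % 3 = 0 then P3Residue.zero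
  else if x.size % 3 = 1 then P3Residue.one
  else P3Residue.two

/-- Partitions with ordinary and primed multiples of 3, as sequences `λ₁ ≥ λ₂ ≥ ⋯` of parts.
Among parts of equal size the primed ones are listed first (the order is `3 < 3' < 6 < 6' < ⋯` on
multiples of 3), so that every partition is represented by exactly one sequence. -/
@[ext]
structure P3Partition where
  parts : List P3Part
  sorted : parts.Pairwise fun x y =>
    y.size < x.size ∨ (y.size = x.size ∧ (y.primed = true → x.primed = true))

namespace P3Partition

/-- The integer that is partitioned. -/
def weight (p : P3Partition) : ℕ := (p.parts.map P3Part.size).sum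

/-- The number of parts whose size is congruent to `r` modulo `N`. -/
def numParts (p : P3Partition) (r N : ℕ) : ℕ :=
  p.parts.countP fun x => decide (x.size ≡ r [MOD N])

/-- The condition on a part `x` and the next part `y` under which their difference is at least 3. -/
def Gap3 (x y : P3Part) : Prop :=
  (x.residue ∈ ({P3Residue.zero, P3Residue.two} : Set P3Residue) ∧
    y.residue ∈ ({P3Residue.zeroPrimed, P3Residue.two} : Set P3Residue)) ∨
  (x.residue ∈ ({P3Residue.zeroPrimed, P3Residue.one} : Set P3Residue) ∧
    y.residue ∈ ({P3Residue.zero, P3Residue.one} : Set P3Residue))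

/-- The condition on a part `x` and the next part `y` under which their difference is at least 4. -/
def Gap4 (x y : P3Part) : Prop :=
  ¬ 3 ∣ x.size ∧ ¬ 3 ∣ y.size ∧ ¬ ((x.size : ℤ) - (y.size : ℤ) ≡ 2 [ZMOD 3])

/-- No part is equal to 1, and consecutive parts satisfy the difference conditions. -/
def IsA3 (p : P3Partition) : Prop :=
  (∀ x ∈ p.parts, x.size ≠ 1) ∧
  p.parts.IsChain fun x y =>
    (Gap3 x y → (3 : ℤ) ≤ (x.size : ℤ) - (y.size : ℤ)) ∧
    (Gap4 x y → (4 : ℤ) ≤ (x.size : ℤ) - (y.size : ℤ))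

/-- Parts not divisible by 3 are congruent to 2 or 4 modulo 6, and neither parts not divisible by 3
nor primed multiples of 3 repeat (ordinary multiples of 3 may). -/
def IsB3 (p : P3Partition) : Prop :=
  (∀ x ∈ p.parts, ¬ 3 ∣ x.size → x.size ≡ 2 [MOD 6] ∨ x.size ≡ 4 [MOD 6]) ∧
  p.parts.Pairwise fun x y => x = y → 3 ∣ x.size ∧ x.primed = false

/-- An integer has finitely many partitions, so the cardinalities below are genuine. -/
theorem finite_weight_eq (n : ℕ) : {p : P3Partition | p.weight = n}.Finite := by
  let f : P3Partition → List (ℕ × Bool) := fun p => p.parts.map fun x => (x.size, x.primed)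
  have hf : Function.Injective f := by
    intro p r h
    apply P3Partition.ext
    refine List.map_injective_iff.mpr ?_ h
    intro x y hxy
    simp only [Prod.mk.injEq] at hxy
    exact P3Part.ext hxy.1 hxy.2
  let g : List (Fin (n + 1) × Bool) → List (ℕ × Bool) := fun l => l.map fun x => (x.1.val, x.2)
  refine Set.Finite.of_finite_image (f := f) ?_ hf.injOn
  refine ((List.finite_length_le (Fin (n + 1) × Bool) n).image g).subset ?_
  rintro _ ⟨p, hp, rfl⟩
  have hp' : (p.parts.map P3Part.size).sum = n := hp
  have hle : ∀ x ∈ p.parts, x.size < n + 1 := by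
    intro x hx
    have := List.le_sum_of_mem (List.mem_map_of_mem (f := P3Part.size) hx)
    omega
  refine ⟨p.parts.map fun x => (Fin.ofNat (n + 1) x.size, x.primed), ?_, ?_⟩
  · have h := List.length_le_sum_of_one_le (p.parts.map P3Part.size) (by
      intro i hi
      obtain ⟨x, _, rfl⟩ := List.mem_map.mp hi
      exact x.pos)
    simp only [List.length_map] at h
    simp only [Set.mem_ofPred_eq, List.length_map]
    omega
  · simp only [g, f, List.map_map]
    refine List.map_congr_left ?_
    intro x hx
    simp [Fin.ofNat, Nat.mod_eq_of_lt (hle x hx)]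

end P3Partition

/-- The number of partitions of `n` satisfying the difference conditions, with `k` parts congruent
to 2 and `m` parts congruent to 1 modulo 3. -/
noncomputable def A3 (n k m : ℕ) : ℕ :=
  {p : P3Partition | p.weight = n ∧ p.IsA3 ∧ p.numParts 2 3 = k ∧ p.numParts 1 3 = m}.ncard

/-- The number of partitions of `n` satisfying the congruence conditions, with `k` parts congruent
to 2 and `m` parts congruent to 4 modulo 6. -/
noncomputable def B3 (n k m : ℕ) : ℕ :=
  {p : P3Partition | p.weight = n ∧ p.IsB3 ∧ p.numParts 2 6 = k ∧ p.numParts 4 6 = m}.ncard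

/-- Formal power series over `ℚ` in three variables `q`, `a`, `d`. -/
abbrev QAD : Type := MvPowerSeries (Fin 3) ℚ

namespace QAD

noncomputable def q : QAD := MvPowerSeries.X 0
noncomputable def a : QAD := MvPowerSeries.X 1
noncomputable def d : QAD := MvPowerSeries.X 2

section
open scoped MvPowerSeries.WithPiTopology

/-- The infinite product `(z; w)_∞ = ∏_{j ≥ 0} (1 - z w ^ j)`, a limit of formal power series
(coefficientwise). -/
noncomputable def qPoch (z w : QAD) : QAD := ∏' j : ℕ, (1 - z * w ^ j)

/-- The product `(z; w)_∞` converges as soon as `w` has no constant term. -/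
theorem multipliable_qPoch (z w : QAD) (hw : MvPowerSeries.constantCoeff w = 0) :
    Multipliable fun j : ℕ => 1 - z * w ^ j := by
  have h : Multipliable fun j : ℕ => 1 + (-(z * w ^ j)) := by
    apply MvPowerSeries.WithPiTopology.multipliable_one_add_of_tendsto_order_atTop_nhds_top
    refine ENat.tendsto_nhds_top_iff_natCast_lt.mpr fun N => ?_
    filter_upwards [Filter.eventually_gt_atTop N] with j hj
    rw [MvPowerSeries.order_neg]
    calc (N : ℕ∞) < (j : ℕ∞) := by exact_mod_cast hj
      _ ≤ (w ^ j).order := MvPowerSeries.le_order_pow_of_constantCoeff_eq_zero j hw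
      _ ≤ z.order + (w ^ j).order := le_add_self
      _ ≤ (z * w ^ j).order := MvPowerSeries.le_order_mul
  simpa only [sub_eq_add_neg] using h

end

end QAD

/-- The generating function `∑ A₃(n; k, m) q ^ n a ^ k d ^ m`; the exponent vector `e` lists the
exponents of `q`, `a` and `d`. -/
noncomputable def A3GenFun : QAD := fun e => (A3 (e 0) (e 1) (e 2) : ℚ)

/-!
Put `Q = q ^ 3`, `x = a * q ^ 2`, `y = d * q ^ 4`. Removing the largest part of a partition counted
by `A3` gives linear relations between the generating functions of such partitions with bounded
parts. They show that the generating function of those with all parts at most `3 * k + 1` is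
`N (k + 1) / ((1 - Q) ⋯ (1 - Q ^ k))` for polynomials `N m = N m (x, y)` (`boundedNumerator`) which
are symmetric in `x` and `y` and satisfy the contiguity relation
`(1 + x) * N (m + 1) (x * Q ^ 2, y) =
  (1 + x * Q ^ (m + 1)) * N (m + 1) (x, y) + x * Q ^ m * (1 - Q ^ (m + 1)) * N m (x, y)`.
Modulo `Q ^ m` this reads `N (m + 1) (x, y) = (1 + x) * N (m + 1) (x * Q ^ 2, y)`, so the factors
`1 + x * Q ^ (2 * i)` and, by symmetry, `1 + y * Q ^ (2 * i)` can be pulled out one after the other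
until `N (m + 1) (0, 0) = (1 + Q) ⋯ (1 + Q ^ m)` remains. The limit over the denominators is the
product in the theorem, which is also the generating function of the partitions counted by `B3`,
whose parts are chosen independently of each other.
-/

/-- For `Q = q ^ 3`, `x = a * q ^ 2`, `y = d * q ^ 4` and `0 < m`, the numerator over
`(1 - Q) ⋯ (1 - Q ^ (m - 1))` of the generating function of the partitions satisfying the difference
conditions with all parts at most `3 * m - 2`. -/
def boundedNumerator {R : Type*} [CommRing R] (Q x y : R) : ℕ → R
  | 0 => 1
  | 1 => 1
  | 2 => (1 + x) * (1 + y) + Q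
  | m + 3 => (1 + Q ^ (m + 2)) * boundedNumerator Q x y (m + 2) +
      ((x + y) * Q ^ (m + 1) + x * y * Q ^ (2 * m + 2)) * boundedNumerator Q x y (m + 1) +
      x * y * Q ^ (2 * m + 1) * (1 - Q ^ (m + 1)) * boundedNumerator Q x y m

namespace boundedNumerator

open Finset

variable {R S : Type*} [CommRing R] [CommRing S] {Q : R} {m : ℕ}

theorem comm (Q x y : R) (m : ℕ) : boundedNumerator Q x y m = boundedNumerator Q y x m := by
  fun_induction boundedNumerator Q x y m with
  | case1 => rfl
  | case2 => rfl
  | case3 => simp only [boundedNumerator, mul_comm]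
  | case4 m ih₂ ih₁ ih₀ => simp only [boundedNumerator, ih₂, ih₁, ih₀, add_comm x, mul_comm x]

theorem map (f : R →+* S) (Q x y : R) (m : ℕ) :
    f (boundedNumerator Q x y m) = boundedNumerator (f Q) (f x) (f y) m := by
  fun_induction boundedNumerator Q x y m with
  | case1 => simp [boundedNumerator]
  | case2 => simp [boundedNumerator]
  | case3 => simp [boundedNumerator]
  | case4 m ih₂ ih₁ ih₀ => simp [boundedNumerator, ih₂, ih₁, ih₀]

theorem one_add_mul_shift (Q x y : R) (m : ℕ) :
    (1 + x) * boundedNumerator Q (x * Q ^ 2) y (m + 1) =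
      (1 + x * Q ^ (m + 1)) * boundedNumerator Q x y (m + 1) +
        x * Q ^ m * (1 - Q ^ (m + 1)) * boundedNumerator Q x y m := by
  induction m using Nat.strong_induction_on with
  | h m ih =>
    match m with
    | 0 => simp only [boundedNumerator]; ring
    | 1 => simp only [boundedNumerator]; ring
    | 2 => simp only [boundedNumerator]; ring
    | m + 3 =>
      have ih₀ := ih m (by omega)
      have ih₁ := ih (m + 1) (by omega)
      have ih₂ := ih (m + 2) (by omega)
      rw [boundedNumerator, boundedNumerator.eq_4 Q x y (m + 1)]
      have hrec := boundedNumerator.eq_4 Q x y m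
      linear_combination (1 + Q ^ (m + 3)) * ih₂ +
        ((x * Q ^ 2 + y) * Q ^ (m + 2) + x * Q ^ 2 * y * Q ^ (2 * m + 4)) * ih₁ +
        x * Q ^ 2 * y * Q ^ (2 * m + 3) * (1 - Q ^ (m + 2)) * ih₀ -
        x * Q ^ (m + 4) * (1 - Q ^ (m + 2)) * hrec

theorem zero_zero (Q : R) (m : ℕ) :
    boundedNumerator Q 0 0 (m + 1) = ∏ i ∈ range m, (1 + Q * Q ^ i) := by
  induction m with
  | zero => rfl
  | succ m ih =>
    rw [prod_range_succ, ← ih]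
    cases m <;> simp only [boundedNumerator] <;> ring

theorem eq_prod_mul_shift (hQ : Q ^ m = 0) (x y : R) (n : ℕ) :
    boundedNumerator Q x y (m + 1) =
      (∏ i ∈ range n, (1 + x * (Q ^ 2) ^ i)) *
        boundedNumerator Q (x * (Q ^ 2) ^ n) y (m + 1) := by
  induction n with
  | zero => simp
  | succ n ih =>
    have hshift := one_add_mul_shift Q (x * (Q ^ 2) ^ n) y m
    rw [pow_succ Q m, hQ] at hshift
    rw [prod_range_succ, pow_succ (Q ^ 2) n, ← mul_assoc x, ih]
    linear_combination -(∏ i ∈ range n, (1 + x * (Q ^ 2) ^ i)) * hshift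

theorem eq_prod_mul_zero (hQ : Q ^ m = 0) (x y : R) :
    boundedNumerator Q x y (m + 1) =
      (∏ i ∈ range m, (1 + x * (Q ^ 2) ^ i)) * boundedNumerator Q 0 y (m + 1) := by
  rw [eq_prod_mul_shift hQ x y m, pow_right_comm, hQ, zero_pow two_ne_zero, mul_zero]

theorem eq_prod (hQ : Q ^ m = 0) (x y : R) :
    boundedNumerator Q x y (m + 1) =
      (∏ i ∈ range m, (1 + x * (Q ^ 2) ^ i)) * (∏ i ∈ range m, (1 + y * (Q ^ 2) ^ i)) *
        ∏ i ∈ range m, (1 + Q * Q ^ i) := by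
  rw [eq_prod_mul_zero hQ, comm, eq_prod_mul_zero hQ, zero_zero, mul_assoc]

theorem pow_dvd_sub_prod (Q x y : R) (m : ℕ) :
    Q ^ m ∣ boundedNumerator Q x y (m + 1) -
      (∏ i ∈ range m, (1 + x * (Q ^ 2) ^ i)) * (∏ i ∈ range m, (1 + y * (Q ^ 2) ^ i)) *
        ∏ i ∈ range m, (1 + Q * Q ^ i) := by
  rw [← Ideal.Quotient.eq_zero_iff_dvd, map_sub, sub_eq_zero, map]
  have hQ : Ideal.Quotient.mk (Ideal.span {Q ^ m}) Q ^ m = 0 := by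
    rw [← map_pow, Ideal.Quotient.eq_zero_iff_dvd]
  rw [eq_prod hQ]
  simp

end boundedNumerator

/-- The relations obtained by removing the largest part of a partition satisfying the difference
conditions, where `Q = q ^ 3`, `x = a * q ^ 2`, `y = d * q ^ 4` and `G k`, `h k`, `w k` are the
generating functions of the partitions all of whose parts are at most `3 * k + 1`, of those which
may follow a part `3 * k + 2`, and of those which may follow a primed part `3 * k + 3`. -/
structure LevelSystem {R : Type*} [CommRing R] (Q x y : R) (G h w : ℕ → R) : Prop where
  G_zero : G 0 = 1
  G_succ : ∀ k, G (k + 1) =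
    G k + x * Q ^ k * h k + Q ^ (k + 1) * h (k + 1) + (Q ^ (k + 1) + y * Q ^ k) * w k
  h_zero : h 0 = 1
  h_succ : ∀ k, h (k + 1) = G k + Q ^ (k + 1) * h (k + 1)
  w_zero : w 0 = 1 + x + Q * w 0
  w_succ : ∀ k, w (k + 1) =
    G (k + 1) - y * Q ^ k * w k + x * Q ^ (k + 1) * h (k + 1) + Q ^ (k + 2) * w (k + 1)

namespace LevelSystem

open Finset

variable {R : Type*} [CommRing R] {Q x y : R} {G h w : ℕ → R}

theorem prod_mul_G_h_w (L : LevelSystem Q x y G h w) (k : ℕ) :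
    (∏ i ∈ range k, (1 - Q * Q ^ i)) * G k = boundedNumerator Q x y (k + 1) ∧
    (∏ i ∈ range k, (1 - Q * Q ^ i)) * h k = boundedNumerator Q x y k ∧
    -- `G_succ` determines `w k` only up to the factor `Q ^ k * (Q + y)`.
    Q ^ k * (Q + y) * ((∏ i ∈ range (k + 1), (1 - Q * Q ^ i)) * w k) =
      boundedNumerator Q x y (k + 2) - boundedNumerator Q x y (k + 1) -
        x * Q ^ k * (1 - Q ^ (k + 1)) * boundedNumerator Q x y k := by
  induction k with
  | zero =>
    refine ⟨by simp [L.G_zero, boundedNumerator], by simp [L.h_zero, boundedNumerator], ?_⟩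
    simp only [boundedNumerator, zero_add, prod_range_one]
    linear_combination (Q + y) * L.w_zero
  | succ k ih =>
    obtain ⟨hG, hh, hw⟩ := ih
    rw [prod_range_succ] at hw
    have hh' : (∏ i ∈ range (k + 1), (1 - Q * Q ^ i)) * h (k + 1) =
        boundedNumerator Q x y (k + 1) := by
      rw [prod_range_succ]
      linear_combination (∏ i ∈ range k, (1 - Q * Q ^ i)) * L.h_succ k + hG
    have hG' : (∏ i ∈ range (k + 1), (1 - Q * Q ^ i)) * G (k + 1) =
        boundedNumerator Q x y (k + 2) := by
      rw [prod_range_succ] at hh' ⊢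
      linear_combination (∏ i ∈ range k, (1 - Q * Q ^ i)) * (1 - Q * Q ^ k) * L.G_succ k +
        (1 - Q ^ (k + 1)) * hG + x * Q ^ k * (1 - Q ^ (k + 1)) * hh + Q ^ (k + 1) * hh' + hw
    refine ⟨hG', hh', ?_⟩
    rw [boundedNumerator, prod_range_succ]
    rw [prod_range_succ] at hG' hh' ⊢
    linear_combination
      Q ^ (k + 1) * (Q + y) * (∏ i ∈ range k, (1 - Q * Q ^ i)) * (1 - Q * Q ^ k) * L.w_succ k +
        Q ^ (k + 1) * (Q + y) * hG' + x * Q ^ (2 * k + 2) * (Q + y) * hh' - y * Q ^ (k + 1) * hw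

theorem prod_mul_G (L : LevelSystem Q x y G h w) (k : ℕ) :
    (∏ i ∈ range k, (1 - Q * Q ^ i)) * G k = boundedNumerator Q x y (k + 1) :=
  (L.prod_mul_G_h_w k).1

end LevelSystem

section Words

variable {α σ k : Type*} {wt : α → σ →₀ ℕ} {R : α → α → Prop} {S T : Set (List α)}

theorem finite_setOf_sum_map_eq {i : σ} (hpos : ∀ t, 0 < wt t i)
    (hfin : ∀ n, {t | wt t i ≤ n}.Finite) (e : σ →₀ ℕ) :
    {l : List α | (l.map wt).sum = e}.Finite := by
  induction hn : e i using Nat.strong_induction_on generalizing e with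
  | h n ih =>
    have hcons : {l : List α | (l.map wt).sum = e} ⊆
        {[]} ∪ ⋃ t ∈ {t | wt t i ≤ n}, List.cons t '' {l | (l.map wt).sum = e - wt t} := by
      rintro (_ | ⟨t, l⟩) rfl
      · exact Or.inl rfl
      · refine Or.inr (Set.mem_biUnion (x := t) ?_ ⟨l, ?_, rfl⟩) <;> simp [← hn]
    refine ((Set.finite_singleton _).union ((hfin n).biUnion fun t ht => ?_)).subset hcons
    refine (ih ((e - wt t) i) ?_ _ rfl).image _
    have := hpos t
    simp only [Finsupp.tsub_apply, Set.mem_ofPred_eq] at ht ⊢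
    omega

variable [Semiring k]

variable (k wt) in
/-- The generating function of a set `S` of words over `α`, a letter `t` having the exponent vector
`wt t`; it is meaningful where only finitely many words of `S` share an exponent vector, since
`Set.ncard` is `0` on infinite sets. -/
noncomputable def wordGenFun (S : Set (List α)) : MvPowerSeries σ k :=
  fun e => ({l ∈ S | (l.map wt).sum = e}.ncard : k)

theorem coeff_wordGenFun (e : σ →₀ ℕ) :
    MvPowerSeries.coeff e (wordGenFun k wt S) = ({l ∈ S | (l.map wt).sum = e}.ncard : k) := rfl

theorem wordGenFun_union (hfin : ∀ e, {l : List α | (l.map wt).sum = e}.Finite)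
    (h : Disjoint S T) : wordGenFun k wt (S ∪ T) = wordGenFun k wt S + wordGenFun k wt T := by
  ext e
  have hsub : ∀ U : Set (List α), {l ∈ U | (l.map wt).sum = e}.Finite :=
    fun U => (hfin e).subset fun l hl => hl.2
  rw [map_add, coeff_wordGenFun, coeff_wordGenFun, coeff_wordGenFun, ← Nat.cast_add,
    ← Set.ncard_union_eq (h.mono (Set.sep_subset _ _) (Set.sep_subset _ _)) (hsub S) (hsub T)]
  congr 2
  ext l
  exact or_and_right

theorem wordGenFun_singleton_nil : wordGenFun k wt {[]} = 1 := by
  classical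
  ext e
  rw [coeff_wordGenFun, MvPowerSeries.coeff_one]
  split_ifs with h
  · rw [Set.sep_eq_self_iff_mem_true.mpr, Set.ncard_singleton, Nat.cast_one]
    rintro _ rfl
    exact h.symm
  · rw [Set.sep_eq_empty_iff_mem_false.mpr, Set.ncard_empty, Nat.cast_zero]
    rintro _ rfl rfl
    exact h rfl

theorem wordGenFun_image_cons (t : α) (S : Set (List α)) :
    wordGenFun k wt (List.cons t '' S) =
      MvPowerSeries.monomial (wt t) 1 * wordGenFun k wt S := by
  classical
  ext e
  rw [MvPowerSeries.coeff_monomial_mul, coeff_wordGenFun, coeff_wordGenFun, one_mul]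
  split_ifs with h
  · rw [← Set.ncard_image_of_injective {l ∈ S | _} (List.cons_injective (a := t))]
    congr 2
    ext l
    simp only [Set.mem_ofPred_eq, Set.mem_image]
    constructor
    · rintro ⟨⟨l', hl', rfl⟩, rfl⟩
      exact ⟨l', ⟨hl', by simp⟩, rfl⟩
    · rintro ⟨l', ⟨hl', hle⟩, rfl⟩
      exact ⟨⟨l', hl', rfl⟩, by simp [hle, add_tsub_cancel_of_le h]⟩
  · rw [Set.sep_eq_empty_iff_mem_false.mpr, Set.ncard_empty, Nat.cast_zero]
    rintro _ ⟨l, -, rfl⟩ rfl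
    exact h (by simp)

/-- The words whose consecutive letters are related by `R` and whose first letter, if there is one,
lies in `T`; the empty word is among them for every `T`. -/
def chainsWithHead (R : α → α → Prop) (T : Set α) : Set (List α) :=
  {l | l.IsChain R ∧ ∀ t ∈ l.head?, t ∈ T}

theorem chainsWithHead_empty : chainsWithHead R ∅ = {[]} := by
  ext (_ | _) <;> simp [chainsWithHead]

theorem chainsWithHead_insert (t : α) (T : Set α) :
    chainsWithHead R (insert t T) =
      chainsWithHead R T ∪ List.cons t '' chainsWithHead R {s | R t s} := by
  ext (_ | ⟨s, l⟩)
  · simp [chainsWithHead]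
  · simp only [chainsWithHead, List.isChain_cons, List.head?_cons, Option.mem_some_iff,
      forall_eq', Set.mem_insert_iff, Set.mem_union, Set.mem_image, Set.mem_ofPred_eq,
      List.cons.injEq]
    grind

variable (k wt) in
/-- The generating function of the words whose consecutive letters are related by `R` and whose
first letter, if there is one, lies in `T`. -/
noncomputable def chainGenFun (R : α → α → Prop) (T : Set α) : MvPowerSeries σ k :=
  wordGenFun k wt (chainsWithHead R T)

theorem chainGenFun_empty : chainGenFun k wt R ∅ = 1 := by
  rw [chainGenFun, chainsWithHead_empty, wordGenFun_singleton_nil]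

theorem chainGenFun_insert (hfin : ∀ e, {l : List α | (l.map wt).sum = e}.Finite) {t : α}
    {T : Set α} (ht : t ∉ T) :
    chainGenFun k wt R (insert t T) = chainGenFun k wt R T +
      MvPowerSeries.monomial (wt t) 1 * chainGenFun k wt R {s | R t s} := by
  have hdisj : Disjoint (chainsWithHead R T) (List.cons t '' chainsWithHead R {s | R t s}) := by
    rw [Set.disjoint_left]
    rintro _ hl ⟨l, -, rfl⟩
    exact ht (hl.2 t rfl)
  rw [chainGenFun, chainsWithHead_insert, wordGenFun_union hfin hdisj, wordGenFun_image_cons]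
  rfl

open Filter MvPowerSeries.WithPiTopology in
theorem tendsto_chainGenFun [TopologicalSpace k] {ι : Type*} {f : Filter ι} {U : ι → Set α}
    {T : Set α} (h : ∀ e, ∀ᶠ i in f, ∀ t, wt t ≤ e → (t ∈ U i ↔ t ∈ T)) :
    Tendsto (fun i => chainGenFun k wt R (U i)) f (nhds (chainGenFun k wt R T)) := by
  refine (tendsto_iff_coeff_tendsto _ _ _).mpr fun e => tendsto_const_nhds.congr' ?_
  filter_upwards [h e] with i hi
  have hhead : ∀ l : List α, (l.map wt).sum = e → ∀ t ∈ l.head?, wt t ≤ e := by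
    rintro l rfl t ht
    exact List.le_sum_of_mem (List.mem_map_of_mem (List.mem_of_mem_head? ht))
  rw [chainGenFun, chainGenFun, coeff_wordGenFun, coeff_wordGenFun]
  congr 2
  ext l
  simp only [chainsWithHead, Set.mem_ofPred_eq]
  grind

end Words

section Chains

variable {α : Type*} {R S : α → α → Prop} {P : α → Prop} {l : List α}

theorem isChain_and_iff : l.IsChain (fun s t => R s t ∧ S s t) ↔ l.IsChain R ∧ l.IsChain S := by
  simp only [List.isChain_iff_getElem, forall_and]

theorem isChain_and_head_iff_forall_mem :
    l.IsChain (fun s t => P t ∧ R s t) ∧ (∀ t ∈ l.head?, P t) ↔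
      (∀ t ∈ l, P t) ∧ l.IsChain R := by
  induction l with
  | nil => simp
  | cons s l ih =>
    simp only [List.isChain_cons, List.mem_cons]
    grind

end Chains

section Limits

open Filter Topology
open scoped MvPowerSeries.WithPiTopology

theorem tendsto_zero_of_pow_dvd {σ R : Type*} [Semiring R] [TopologicalSpace R]
    {Q : MvPowerSeries σ R} (hQ : MvPowerSeries.constantCoeff Q = 0) {u : ℕ → MvPowerSeries σ R}
    (h : ∀ k, Q ^ k ∣ u k) : Tendsto u atTop (𝓝 0) := by
  refine (MvPowerSeries.WithPiTopology.tendsto_iff_coeff_tendsto _ _ _).mpr fun e => ?_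
  refine tendsto_const_nhds.congr' ?_
  filter_upwards [eventually_gt_atTop e.degree] with k hk
  obtain ⟨v, hv⟩ := h k
  refine (MvPowerSeries.coeff_of_lt_order ?_).symm
  calc (e.degree : ℕ∞) < k := by exact_mod_cast hk
    _ ≤ (Q ^ k).order := MvPowerSeries.le_order_pow_of_constantCoeff_eq_zero k hQ
    _ ≤ (Q ^ k).order + v.order := le_self_add
    _ ≤ (u k).order := hv ▸ MvPowerSeries.le_order_mul

namespace QAD

variable {z w : QAD}

theorem tendsto_qPoch (z : QAD) (hw : MvPowerSeries.constantCoeff w = 0) :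
    Tendsto (fun n => ∏ j ∈ Finset.range n, (1 - z * w ^ j)) atTop (𝓝 (qPoch z w)) :=
  (multipliable_qPoch z w hw).tendsto_prod_tprod_nat

theorem tendsto_qPoch_neg (z : QAD) (hw : MvPowerSeries.constantCoeff w = 0) :
    Tendsto (fun n => ∏ j ∈ Finset.range n, (1 + z * w ^ j)) atTop (𝓝 (qPoch (-z) w)) := by
  simpa using tendsto_qPoch (-z) hw

theorem constantCoeff_qPoch (hz : MvPowerSeries.constantCoeff z = 0)
    (hw : MvPowerSeries.constantCoeff w = 0) : MvPowerSeries.constantCoeff (qPoch z w) = 1 := by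
  have hlim := ((MvPowerSeries.WithPiTopology.continuous_constantCoeff ℚ).tendsto _).comp
    (tendsto_qPoch z hw)
  refine tendsto_nhds_unique hlim (tendsto_const_nhds.congr fun n => ?_)
  simp [hz]

end QAD

end Limits

namespace P3Part

/-- The enumeration `2, 3, 3', 4, 5, 6, 6', 7, …` of the parts other than 1, in increasing order. -/
def nth (t : ℕ) : P3Part where
  size := t + 2 - (t + 2) / 4
  primed := t % 4 = 2
  pos := by omega
  dvd_of_primed h := by
    have := of_decide_eq_true h
    omega

theorem size_nth (t : ℕ) : (nth t).size = t + 2 - (t + 2) / 4 := rfl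

theorem primed_nth (t : ℕ) : (nth t).primed = decide (t % 4 = 2) := rfl

theorem nth_injective : Function.Injective nth := by
  intro s t h
  have hsize := congrArg size h
  have hprimed := congrArg primed h
  rw [size_nth, size_nth] at hsize
  rw [primed_nth, primed_nth, decide_eq_decide] at hprimed
  omega

theorem range_nth : Set.range nth = {x | x.size ≠ 1} := by
  ext x
  constructor
  · rintro ⟨t, rfl⟩
    rw [Set.mem_ofPred_eq, size_nth]
    omega
  · intro (hx : x.size ≠ 1)
    have hpos := x.pos
    have hdvd := x.dvd_of_primed
    cases hp : x.primed
    · refine ⟨(4 * x.size - 7) / 3, P3Part.ext ?_ ?_⟩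
      · rw [size_nth]
        omega
      · rw [primed_nth, hp, decide_eq_false_iff_not]
        omega
    · have := hdvd hp
      refine ⟨(4 * x.size - 6) / 3, P3Part.ext ?_ ?_⟩
      · rw [size_nth]
        omega
      · rw [primed_nth, hp, decide_eq_true_eq]
        omega

theorem residue_nth (t : ℕ) : (nth t).residue =
    if t % 4 = 0 then .two else if t % 4 = 1 then .zero
    else if t % 4 = 2 then .zeroPrimed else .one := by
  have ht : t % 4 = 0 ∨ t % 4 = 1 ∨ t % 4 = 2 ∨ t % 4 = 3 := by omega
  have hsize := size_nth t
  simp only [residue, primed_nth, decide_eq_true_eq]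
  rcases ht with h | h | h | h <;> simp only [h] <;> grind

theorem nth_le_nth_iff (s t : ℕ) :
    (nth t).size < (nth s).size ∨
      ((nth t).size = (nth s).size ∧ ((nth t).primed = true → (nth s).primed = true)) ↔ t ≤ s := by
  simp only [size_nth, primed_nth, decide_eq_true_eq]
  omega

/-- The exponents of `q`, `a` and `d` contributed by a part; parts congruent to 2 and to 1 modulo 3
are marked by `a` and `d` respectively. -/
noncomputable def exponents (x : P3Part) : Fin 3 →₀ ℕ :=
  Finsupp.single 0 x.size + Finsupp.single 1 (if x.size ≡ 2 [MOD 3] then 1 else 0) +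
    Finsupp.single 2 (if x.size ≡ 1 [MOD 3] then 1 else 0)

theorem exponents_nth_apply_zero (t : ℕ) : (nth t).exponents 0 = t + 2 - (t + 2) / 4 := by
  simp [exponents, size_nth]

open QAD in
theorem monomial_exponents (x : P3Part) : (MvPowerSeries.monomial x.exponents 1 : QAD) =
    q ^ x.size * a ^ (if x.size ≡ 2 [MOD 3] then 1 else 0) *
      d ^ (if x.size ≡ 1 [MOD 3] then 1 else 0) := by
  rw [q, a, d, MvPowerSeries.X_pow_eq, MvPowerSeries.X_pow_eq, MvPowerSeries.X_pow_eq,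
    MvPowerSeries.monomial_mul_monomial, MvPowerSeries.monomial_mul_monomial, one_mul, one_mul]
  rfl

section

open QAD

variable {t k : ℕ}

theorem monomial_exponents_nth_four_mul (ht : t = 4 * k) :
    (MvPowerSeries.monomial (nth t).exponents 1 : QAD) = a * q ^ 2 * (q ^ 3) ^ k := by
  have hsize : (nth t).size = 3 * k + 2 := by rw [size_nth]; omega
  rw [monomial_exponents, hsize, if_pos (by unfold Nat.ModEq; omega),
    if_neg (by unfold Nat.ModEq; omega)]
  ring

theorem monomial_exponents_nth_four_mul_add_one (ht : t = 4 * k + 1) :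
    (MvPowerSeries.monomial (nth t).exponents 1 : QAD) = (q ^ 3) ^ (k + 1) := by
  have hsize : (nth t).size = 3 * k + 3 := by rw [size_nth]; omega
  rw [monomial_exponents, hsize, if_neg (by unfold Nat.ModEq; omega),
    if_neg (by unfold Nat.ModEq; omega)]
  ring

theorem monomial_exponents_nth_four_mul_add_two (ht : t = 4 * k + 2) :
    (MvPowerSeries.monomial (nth t).exponents 1 : QAD) = (q ^ 3) ^ (k + 1) := by
  have hsize : (nth t).size = 3 * k + 3 := by rw [size_nth]; omega
  rw [monomial_exponents, hsize, if_neg (by unfold Nat.ModEq; omega),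
    if_neg (by unfold Nat.ModEq; omega)]
  ring

theorem monomial_exponents_nth_four_mul_add_three (ht : t = 4 * k + 3) :
    (MvPowerSeries.monomial (nth t).exponents 1 : QAD) = d * q ^ 4 * (q ^ 3) ^ k := by
  have hsize : (nth t).size = 3 * k + 4 := by rw [size_nth]; omega
  rw [monomial_exponents, hsize, if_neg (by unfold Nat.ModEq; omega),
    if_pos (by unfold Nat.ModEq; omega)]
  ring

end

end P3Part

namespace P3Partition

theorem sum_exponents (p : P3Partition) : (p.parts.map P3Part.exponents).sum =
    Finsupp.single 0 p.weight + Finsupp.single 1 (p.numParts 2 3) +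
      Finsupp.single 2 (p.numParts 1 3) := by
  simp only [weight, numParts]
  induction p.parts with
  | nil => simp
  | cons x l ih =>
    simp only [List.map_cons, List.sum_cons, ih, List.countP_cons, P3Part.exponents,
      Finsupp.single_add, decide_eq_true_eq]
    abel

theorem sum_exponents_eq_iff (p : P3Partition) (e : Fin 3 →₀ ℕ) :
    (p.parts.map P3Part.exponents).sum = e ↔
      p.weight = e 0 ∧ p.numParts 2 3 = e 1 ∧ p.numParts 1 3 = e 2 := by
  simp [sum_exponents, Finsupp.ext_iff, Fin.forall_fin_succ]

theorem exists_parts_eq_map_nth_iff {l : List ℕ} :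
    (∃ p : P3Partition, p.parts = l.map P3Part.nth) ↔ l.Pairwise (· ≥ ·) := by
  simp only [ge_iff_le, ← P3Part.nth_le_nth_iff]
  rw [← List.pairwise_map (f := P3Part.nth) (R := fun x y => y.size < x.size ∨
    (y.size = x.size ∧ (y.primed = true → x.primed = true)))]
  exact ⟨fun ⟨p, hp⟩ => hp ▸ p.sorted, fun h => ⟨⟨_, h⟩, rfl⟩⟩

theorem ncard_eq_ncard_words {C : P3Partition → Prop} {S : Set (List ℕ)}
    (hC : ∀ p, C p → ∀ x ∈ p.parts, x.size ≠ 1)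
    (hS : ∀ l, l ∈ S ↔ ∃ p, C p ∧ p.parts = l.map P3Part.nth) (e : Fin 3 →₀ ℕ) :
    {p | C p ∧ (p.parts.map P3Part.exponents).sum = e}.ncard =
      {l ∈ S | (l.map fun t => (P3Part.nth t).exponents).sum = e}.ncard := by
  rw [← Set.ncard_image_of_injective _ fun p r : P3Partition => P3Partition.ext,
    ← Set.ncard_image_of_injective _ (List.map_injective_iff.mpr P3Part.nth_injective)]
  congr 1
  ext L
  constructor
  · rintro ⟨p, ⟨hp, rfl⟩, rfl⟩
    obtain ⟨l, hl⟩ : p.parts ∈ Set.range (List.map P3Part.nth) := by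
      rw [Set.range_list_map, P3Part.range_nth]
      exact hC p hp
    refine ⟨l, ⟨(hS l).mpr ⟨p, hp, hl.symm⟩, ?_⟩, hl⟩
    rw [← hl, List.map_map]
    rfl
  · rintro ⟨l, ⟨hl, rfl⟩, rfl⟩
    obtain ⟨p, hp, hpl⟩ := (hS l).mp hl
    refine ⟨p, ⟨hp, ?_⟩, hpl⟩
    rw [hpl, List.map_map]
    rfl

theorem gap3_nth_iff (s t : ℕ) : Gap3 (P3Part.nth s) (P3Part.nth t) ↔
    (s % 4 ≤ 1 ∧ t % 2 = 0) ∨ (2 ≤ s % 4 ∧ t % 2 = 1) := by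
  simp only [Gap3, P3Part.residue_nth, Set.mem_insert_iff, Set.mem_singleton_iff]
  grind

theorem gap4_nth_iff (s t : ℕ) : Gap4 (P3Part.nth s) (P3Part.nth t) ↔
    (s % 4 = 0 ∧ (t % 4 = 0 ∨ t % 4 = 3)) ∨ (s % 4 = 3 ∧ t % 4 = 3) := by
  unfold Gap4 Int.ModEq
  rw [P3Part.size_nth, P3Part.size_nth]
  omega

/-- The part at position `t` of the enumeration `P3Part.nth` may be the next part after the one at
position `s` in a partition satisfying the difference conditions. -/
def RelA (s t : ℕ) : Prop :=
  (s % 4 = 0 ∧ (t + 3 = s ∨ t + 4 < s)) ∨ (s % 4 = 1 ∧ (t = s ∨ t + 1 < s)) ∨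
    (s % 4 = 2 ∧ (t = s ∨ t + 2 = s ∨ (t + 2 < s ∧ t + 3 ≠ s))) ∨
    (s % 4 = 3 ∧ (t + 1 = s ∨ t + 3 = s ∨ (t + 3 < s ∧ t + 4 ≠ s)))

theorem relA_iff (s t : ℕ) :
    RelA s t ↔ t ≤ s ∧ (Gap3 (P3Part.nth s) (P3Part.nth t) →
        (3 : ℤ) ≤ ((P3Part.nth s).size : ℤ) - ((P3Part.nth t).size : ℤ)) ∧
      (Gap4 (P3Part.nth s) (P3Part.nth t) →
        (4 : ℤ) ≤ ((P3Part.nth s).size : ℤ) - ((P3Part.nth t).size : ℤ)) := by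
  rw [gap3_nth_iff, gap4_nth_iff, P3Part.size_nth, P3Part.size_nth]
  unfold RelA
  omega

theorem exists_isA3_iff (l : List ℕ) :
    (∃ p : P3Partition, p.IsA3 ∧ p.parts = l.map P3Part.nth) ↔ l.IsChain RelA := by
  have hne : ∀ x ∈ l.map P3Part.nth, x.size ≠ 1 := fun x hx => by
    obtain ⟨t, -, rfl⟩ := List.mem_map.mp hx
    exact P3Part.range_nth.subset ⟨t, rfl⟩
  rw [List.IsChain.iff relA_iff, isChain_and_iff (R := fun s t => t ≤ s),
    List.isChain_iff_pairwise]
  constructor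
  · rintro ⟨p, hp, hpl⟩
    exact ⟨exists_parts_eq_map_nth_iff.mp ⟨p, hpl⟩, (List.isChain_map _).mp (hpl ▸ hp.2)⟩
  · rintro ⟨hsorted, hgaps⟩
    obtain ⟨p, hp⟩ := exists_parts_eq_map_nth_iff.mpr hsorted
    exact ⟨p, ⟨hp ▸ hne, hp ▸ (List.isChain_map _).mpr hgaps⟩, hp⟩

/-- The part at position `t` of the enumeration `P3Part.nth` may occur in a partition satisfying the
congruence conditions. -/
def LetterB (t : ℕ) : Prop := t % 4 = 1 ∨ t % 4 = 2 ∨ t % 8 = 0 ∨ t % 8 = 3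

/-- The part at position `t` of the enumeration `P3Part.nth` may be the next part after the one at
position `s` in a partition satisfying the congruence conditions. -/
def RelB (s t : ℕ) : Prop := LetterB t ∧ (t < s ∨ (t = s ∧ s % 4 = 1))

theorem letterB_iff (t : ℕ) : LetterB t ↔ (¬ 3 ∣ (P3Part.nth t).size →
      (P3Part.nth t).size ≡ 2 [MOD 6] ∨ (P3Part.nth t).size ≡ 4 [MOD 6]) := by
  have hsize := P3Part.size_nth t
  unfold LetterB Nat.ModEq
  omega

theorem repeats_iff (s t : ℕ) : (t < s ∨ (t = s ∧ s % 4 = 1)) ↔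
    t ≤ s ∧ (P3Part.nth s = P3Part.nth t →
      3 ∣ (P3Part.nth s).size ∧ (P3Part.nth s).primed = false) := by
  have hsize := P3Part.size_nth s
  rw [P3Part.nth_injective.eq_iff, P3Part.primed_nth, decide_eq_false_iff_not]
  omega

theorem IsB3.size_ne_one {p : P3Partition} (h : p.IsB3) : ∀ x ∈ p.parts, x.size ≠ 1 := by
  intro x hx hone
  have := h.1 x hx
  rw [hone] at this
  exact absurd (this (by decide)) (by decide)

theorem IsB3.numParts_eq {p : P3Partition} (h : p.IsB3) :
    p.numParts 2 6 = p.numParts 2 3 ∧ p.numParts 4 6 = p.numParts 1 3 := by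
  constructor <;>
  · refine List.countP_congr fun x hx => ?_
    have := h.1 x hx
    rw [decide_eq_true_eq, decide_eq_true_eq]
    unfold Nat.ModEq at *
    omega

theorem exists_isB3_iff (l : List ℕ) :
    (∃ p : P3Partition, p.IsB3 ∧ p.parts = l.map P3Part.nth) ↔
      l.IsChain RelB ∧ ∀ t ∈ l.head?, LetterB t := by
  have : IsTrans ℕ fun s t => t < s ∨ (t = s ∧ s % 4 = 1) := ⟨fun r s t => by omega⟩
  unfold RelB
  rw [isChain_and_head_iff_forall_mem, List.isChain_iff_pairwise]
  simp only [letterB_iff, repeats_iff, List.pairwise_and_iff]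
  constructor
  · rintro ⟨p, ⟨hmem, hrep⟩, hpl⟩
    rw [hpl] at hmem hrep
    exact ⟨List.forall_mem_map.mp hmem, exists_parts_eq_map_nth_iff.mp ⟨p, hpl⟩,
      List.pairwise_map.mp hrep⟩
  · rintro ⟨hmem, hsorted, hrep⟩
    obtain ⟨p, hp⟩ := exists_parts_eq_map_nth_iff.mpr hsorted
    exact ⟨p, ⟨hp ▸ List.forall_mem_map.mpr hmem, hp ▸ List.pairwise_map.mpr hrep⟩, hp⟩

theorem finite_setOf_sum_exponents_eq (e : Fin 3 →₀ ℕ) :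
    {l : List ℕ | (l.map fun t => (P3Part.nth t).exponents).sum = e}.Finite := by
  refine finite_setOf_sum_map_eq (i := 0) (fun t => ?_) (fun n => ?_) e
  · rw [P3Part.exponents_nth_apply_zero]
    omega
  · refine (Set.finite_lt_nat (2 * n)).subset fun t ht => ?_
    rw [Set.mem_ofPred_eq, P3Part.exponents_nth_apply_zero] at ht
    change t < 2 * n
    omega

/-- The generating function of the partitions satisfying the difference conditions whose largest
part, if there is one, has its position (in the enumeration `P3Part.nth`) in `T`. -/
noncomputable def genFunA (T : Set ℕ) : QAD :=
  chainGenFun ℚ (fun t => (P3Part.nth t).exponents) RelA T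

/-- The generating function of the partitions satisfying the congruence conditions whose largest
part, if there is one, has its position in `T`; `T` is to consist of positions satisfying `LetterB`,
since `RelB` does not constrain the first part. -/
noncomputable def genFunB (T : Set ℕ) : QAD :=
  chainGenFun ℚ (fun t => (P3Part.nth t).exponents) RelB T

theorem coeff_genFunA_univ (e : Fin 3 →₀ ℕ) :
    MvPowerSeries.coeff e (genFunA Set.univ) = A3 (e 0) (e 1) (e 2) := by
  rw [genFunA, chainGenFun, coeff_wordGenFun,
    ← ncard_eq_ncard_words (C := IsA3) (fun p hp => hp.1) fun l => by
      simp [exists_isA3_iff, chainsWithHead], A3]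
  congr 2
  ext p
  simp only [Set.mem_ofPred_eq, sum_exponents_eq_iff]
  tauto

theorem coeff_genFunB_letterB (e : Fin 3 →₀ ℕ) :
    MvPowerSeries.coeff e (genFunB {t | LetterB t}) = B3 (e 0) (e 1) (e 2) := by
  rw [genFunB, chainGenFun, coeff_wordGenFun,
    ← ncard_eq_ncard_words (C := IsB3) (S := chainsWithHead RelB {t | LetterB t})
      (fun p hp => hp.size_ne_one) fun l => (exists_isB3_iff l).symm, B3]
  congr 2
  ext p
  simp only [Set.mem_ofPred_eq, sum_exponents_eq_iff]
  refine ⟨fun ⟨hB, hw, h2, h1⟩ => ⟨hw, hB, ?_, ?_⟩, fun ⟨hw, hB, h2, h4⟩ => ⟨hB, hw, ?_, ?_⟩⟩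
  · rw [hB.numParts_eq.1, h2]
  · rw [hB.numParts_eq.2, h1]
  · rw [← hB.numParts_eq.1, h2]
  · rw [← hB.numParts_eq.2, h4]

open QAD P3Part

theorem genFunA_empty : genFunA ∅ = 1 := chainGenFun_empty

theorem genFunA_insert {t : ℕ} {T : Set ℕ} (ht : t ∉ T) : genFunA (insert t T) =
    genFunA T + MvPowerSeries.monomial (nth t).exponents 1 * genFunA {s | RelA t s} :=
  chainGenFun_insert finite_setOf_sum_exponents_eq ht

theorem genFunA_Iio_succ (N : ℕ) : genFunA (Set.Iio (N + 1)) = genFunA (Set.Iio N) +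
    MvPowerSeries.monomial (nth N).exponents 1 * genFunA {s | RelA N s} := by
  rw [← genFunA_insert Set.self_notMem_Iio, ← Order.Iio_succ_eq_insert, Order.succ_eq_add_one]

theorem setOf_relA_four_mul_succ (k : ℕ) :
    {t | RelA (4 * (k + 1)) t} = insert (4 * k + 1) (Set.Iio (4 * k)) := by
  ext t
  simp only [RelA, Set.mem_insert_iff, Set.mem_ofPred_eq, Set.mem_Iio]
  omega

theorem setOf_relA_four_mul_add_one (k : ℕ) :
    {t | RelA (4 * k + 1) t} = {t | RelA (4 * (k + 1)) t} := by
  ext t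
  simp only [RelA, Set.mem_ofPred_eq]
  omega

theorem setOf_relA_four_mul_add_three (k : ℕ) :
    {t | RelA (4 * k + 3) t} = {t | RelA (4 * k + 2) t} := by
  ext t
  simp only [RelA, Set.mem_ofPred_eq]
  omega

theorem setOf_relA_four_mul_add_six (k : ℕ) : {t | RelA (4 * (k + 1) + 2) t} =
    insert (4 * (k + 1) + 2) (insert (4 * (k + 1)) (Set.Iio (4 * k + 3))) := by
  ext t
  simp only [RelA, Set.mem_insert_iff, Set.mem_ofPred_eq, Set.mem_Iio]
  omega

theorem setOf_relA_zero : {t | RelA 0 t} = ∅ := by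
  ext t
  simp [RelA]

theorem setOf_relA_two : {t | RelA 2 t} = {2, 0} := by
  ext t
  simp only [Set.mem_insert_iff, Set.mem_singleton_iff, Set.mem_ofPred_eq]
  unfold RelA
  omega

theorem genFunA_Iio_four_mul_succ (k : ℕ) : genFunA (Set.Iio (4 * (k + 1))) =
    genFunA (Set.Iio (4 * k + 3)) +
      d * q ^ 4 * (q ^ 3) ^ k * genFunA {t | RelA (4 * k + 2) t} := by
  rw [show 4 * (k + 1) = 4 * k + 3 + 1 by ring, genFunA_Iio_succ,
    monomial_exponents_nth_four_mul_add_three rfl, setOf_relA_four_mul_add_three]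

theorem levelSystem_genFunA : LevelSystem (q ^ 3) (a * q ^ 2) (d * q ^ 4)
    (fun k => genFunA (Set.Iio (4 * k))) (fun k => genFunA {t | RelA (4 * k) t})
    (fun k => genFunA {t | RelA (4 * k + 2) t}) where
  G_zero := by simp [genFunA_empty]
  G_succ k := by
    rw [genFunA_Iio_four_mul_succ, genFunA_Iio_succ, genFunA_Iio_succ, genFunA_Iio_succ,
      monomial_exponents_nth_four_mul rfl, monomial_exponents_nth_four_mul_add_one rfl,
      monomial_exponents_nth_four_mul_add_two rfl, setOf_relA_four_mul_add_one]
    ring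
  h_zero := by rw [mul_zero, setOf_relA_zero, genFunA_empty]
  h_succ k := by
    nth_rw 1 [setOf_relA_four_mul_succ]
    rw [genFunA_insert (by simp), monomial_exponents_nth_four_mul_add_one rfl,
      setOf_relA_four_mul_add_one]
  w_zero := by
    rw [mul_zero, zero_add]
    nth_rw 1 [setOf_relA_two]
    rw [genFunA_insert (by simp), ← insert_empty_eq 0, genFunA_insert (Set.notMem_empty 0),
      monomial_exponents_nth_four_mul (k := 0) rfl,
      monomial_exponents_nth_four_mul_add_two (k := 0) rfl, genFunA_empty, setOf_relA_zero,
      genFunA_empty]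
    ring
  w_succ k := by
    nth_rw 1 [setOf_relA_four_mul_add_six]
    rw [genFunA_insert (by simp [mul_add]), genFunA_insert (by simp [mul_add]),
      monomial_exponents_nth_four_mul rfl, monomial_exponents_nth_four_mul_add_two rfl,
      genFunA_Iio_four_mul_succ]
    ring

theorem genFunB_insert {t : ℕ} {T : Set ℕ} (ht : t ∉ T) : genFunB (insert t T) =
    genFunB T + MvPowerSeries.monomial (nth t).exponents 1 * genFunB {s | RelB t s} :=
  chainGenFun_insert finite_setOf_sum_exponents_eq ht

/-- The generating function of the partitions satisfying the congruence conditions with all parts at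
positions below `N`. -/
noncomputable def boundedGenFunB (N : ℕ) : QAD := genFunB {t | t < N ∧ LetterB t}

theorem boundedGenFunB_zero : boundedGenFunB 0 = 1 := by
  have hempty : {t | t < 0 ∧ LetterB t} = ∅ := by simp
  rw [boundedGenFunB, hempty, genFunB, chainGenFun_empty]

theorem boundedGenFunB_succ {N : ℕ} (hN : LetterB N) : boundedGenFunB (N + 1) =
    boundedGenFunB N + MvPowerSeries.monomial (nth N).exponents 1 * genFunB {t | RelB N t} := by
  rw [boundedGenFunB, boundedGenFunB, ← genFunB_insert fun h => h.1.false]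
  congr 1
  ext t
  simp only [Set.mem_ofPred_eq, Set.mem_insert_iff]
  grind

theorem boundedGenFunB_succ_of_not {N : ℕ} (hN : ¬ LetterB N) :
    boundedGenFunB (N + 1) = boundedGenFunB N := by
  unfold boundedGenFunB
  grind

theorem boundedGenFunB_succ_of_distinct {N : ℕ} (hN : LetterB N) (h1 : N % 4 ≠ 1) :
    boundedGenFunB (N + 1) =
      (1 + MvPowerSeries.monomial (nth N).exponents 1) * boundedGenFunB N := by
  have hrel : {t | RelB N t} = {t | t < N ∧ LetterB t} := by
    simp [RelB, h1, and_comm]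
  rw [boundedGenFunB_succ hN, hrel, add_mul, one_mul]
  rfl

theorem boundedGenFunB_succ_of_repeatable {N : ℕ} (h1 : N % 4 = 1) :
    (1 - MvPowerSeries.monomial (nth N).exponents 1) * boundedGenFunB (N + 1) =
      boundedGenFunB N := by
  have hrel : {t | RelB N t} = {t | t < N + 1 ∧ LetterB t} := by
    simp [RelB, h1, and_comm, ← le_iff_lt_or_eq]
  have hsucc := boundedGenFunB_succ (N := N) (Or.inl h1)
  rw [hrel, ← boundedGenFunB] at hsucc
  linear_combination hsucc

theorem boundedGenFunB_eight_mul_add_four (m : ℕ) :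
    (1 - (q ^ 3) ^ (2 * m + 1)) * boundedGenFunB (8 * m + 4) =
      (1 + a * q ^ 2 * (q ^ 3) ^ (2 * m)) * (1 + (q ^ 3) ^ (2 * m + 1)) *
        (1 + d * q ^ 4 * (q ^ 3) ^ (2 * m)) * boundedGenFunB (8 * m) := by
  have h₀ := boundedGenFunB_succ_of_distinct (N := 8 * m) (by unfold LetterB; omega) (by omega)
  have h₁ := boundedGenFunB_succ_of_repeatable (N := 8 * m + 1) (by omega)
  have h₂ := boundedGenFunB_succ_of_distinct (N := 8 * m + 2) (by unfold LetterB; omega)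
    (by omega)
  have h₃ := boundedGenFunB_succ_of_distinct (N := 8 * m + 3) (by unfold LetterB; omega)
    (by omega)
  rw [monomial_exponents_nth_four_mul (k := 2 * m) (by omega)] at h₀
  rw [monomial_exponents_nth_four_mul_add_one (k := 2 * m) (by omega)] at h₁
  rw [monomial_exponents_nth_four_mul_add_two (k := 2 * m) (by omega)] at h₂
  rw [monomial_exponents_nth_four_mul_add_three (k := 2 * m) (by omega)] at h₃
  rw [h₃, h₂]
  linear_combination (1 + d * q ^ 4 * (q ^ 3) ^ (2 * m)) * (1 + (q ^ 3) ^ (2 * m + 1)) * (h₁ + h₀)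

theorem boundedGenFunB_eight_mul_add_eight (m : ℕ) :
    (1 - (q ^ 3) ^ (2 * m + 2)) * boundedGenFunB (8 * m + 8) =
      (1 + (q ^ 3) ^ (2 * m + 2)) * boundedGenFunB (8 * m + 4) := by
  have h₁ := boundedGenFunB_succ_of_repeatable (N := 8 * m + 5) (by omega)
  rw [monomial_exponents_nth_four_mul_add_one (k := 2 * m + 1) (by omega),
    boundedGenFunB_succ_of_not (N := 8 * m + 4) (by unfold LetterB; omega)] at h₁
  rw [boundedGenFunB_succ_of_not (N := 8 * m + 7) (by unfold LetterB; omega),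
    boundedGenFunB_succ_of_distinct (by unfold LetterB; omega) (by omega),
    monomial_exponents_nth_four_mul_add_two (k := 2 * m + 1) (by omega)]
  linear_combination (1 + (q ^ 3) ^ (2 * m + 2)) * h₁

open Finset in
theorem prod_mul_boundedGenFunB (m : ℕ) :
    (∏ i ∈ range (2 * m), (1 - q ^ 3 * (q ^ 3) ^ i)) * boundedGenFunB (8 * m) =
      (∏ i ∈ range m, (1 + a * q ^ 2 * ((q ^ 3) ^ 2) ^ i)) *
        (∏ i ∈ range m, (1 + d * q ^ 4 * ((q ^ 3) ^ 2) ^ i)) *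
        ∏ i ∈ range (2 * m), (1 + q ^ 3 * (q ^ 3) ^ i) := by
  induction m with
  | zero => simp [boundedGenFunB_zero]
  | succ m ih =>
    have h₄ := boundedGenFunB_eight_mul_add_four m
    have h₈ := boundedGenFunB_eight_mul_add_eight m
    simp only [mul_add, mul_one, prod_range_succ, ← pow_succ', ← pow_mul (q ^ 3)] at h₈ ih ⊢
    linear_combination (∏ i ∈ range (2 * m), (1 - (q ^ 3) ^ (i + 1))) *
        (1 - (q ^ 3) ^ (2 * m + 1)) * h₈ +
      (∏ i ∈ range (2 * m), (1 - (q ^ 3) ^ (i + 1))) * (1 + (q ^ 3) ^ (2 * m + 2)) * h₄ +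
      (1 + a * q ^ 2 * (q ^ 3) ^ (2 * m)) * (1 + (q ^ 3) ^ (2 * m + 1)) *
        (1 + d * q ^ 4 * (q ^ 3) ^ (2 * m)) * (1 + (q ^ 3) ^ (2 * m + 2)) * ih

open Filter Topology
open scoped MvPowerSeries.WithPiTopology

theorem constantCoeff_q_pow {n : ℕ} (hn : n ≠ 0) : MvPowerSeries.constantCoeff (q ^ n) = 0 := by
  simp [q, hn]

theorem eventually_lt_of_exponents_le (e : Fin 3 →₀ ℕ) :
    ∀ᶠ N in atTop, ∀ t, (P3Part.nth t).exponents ≤ e → t < N := by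
  filter_upwards [eventually_ge_atTop (2 * e 0)] with N hN t ht
  have := ht 0
  rw [P3Part.exponents_nth_apply_zero] at this
  omega

theorem tendsto_genFunA_Iio :
    Tendsto (fun N => genFunA (Set.Iio N)) atTop (𝓝 (genFunA Set.univ)) :=
  tendsto_chainGenFun fun e => (eventually_lt_of_exponents_le e).mono fun _ hN t ht =>
    iff_of_true (hN t ht) trivial

theorem tendsto_boundedGenFunB :
    Tendsto boundedGenFunB atTop (𝓝 (genFunB {t | LetterB t})) :=
  tendsto_chainGenFun fun e => (eventually_lt_of_exponents_le e).mono fun _ hN t ht =>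
    and_iff_right (hN t ht)

theorem qPoch_mul_genFunA : qPoch (q ^ 3) (q ^ 3) * genFunA Set.univ =
    qPoch (-(a * q ^ 2)) (q ^ 6) * qPoch (-(d * q ^ 4)) (q ^ 6) * qPoch (-q ^ 3) (q ^ 3) := by
  have hQ := constantCoeff_q_pow three_ne_zero
  have hQ2 := constantCoeff_q_pow (n := 6) (by norm_num)
  have hprod := ((tendsto_qPoch_neg (a * q ^ 2) hQ2).mul (tendsto_qPoch_neg (d * q ^ 4) hQ2)).mul
    (tendsto_qPoch_neg (q ^ 3) hQ)
  have hdiff := tendsto_zero_of_pow_dvd hQ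
    (boundedNumerator.pow_dvd_sub_prod (q ^ 3) (a * q ^ 2) (d * q ^ 4))
  have hlhs := (tendsto_qPoch (q ^ 3) hQ).mul
    (tendsto_genFunA_Iio.comp (tendsto_id.const_mul_atTop' four_pos))
  refine tendsto_nhds_unique hlhs ?_
  rw [← zero_add (_ * _ * _)]
  refine (hdiff.add hprod).congr fun k => ?_
  rw [← pow_mul q 3 2, sub_add_cancel]
  exact (levelSystem_genFunA.prod_mul_G k).symm

theorem qPoch_mul_genFunB : qPoch (q ^ 3) (q ^ 3) * genFunB {t | LetterB t} =
    qPoch (-(a * q ^ 2)) (q ^ 6) * qPoch (-(d * q ^ 4)) (q ^ 6) * qPoch (-q ^ 3) (q ^ 3) := by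
  have hQ := constantCoeff_q_pow three_ne_zero
  have hQ2 := constantCoeff_q_pow (n := 6) (by norm_num)
  have htwo : Tendsto (fun m : ℕ => 2 * m) atTop atTop := tendsto_id.const_mul_atTop' two_pos
  have hprod := ((tendsto_qPoch_neg (a * q ^ 2) hQ2).mul (tendsto_qPoch_neg (d * q ^ 4) hQ2)).mul
    ((tendsto_qPoch_neg (q ^ 3) hQ).comp htwo)
  have hlhs := ((tendsto_qPoch (q ^ 3) hQ).comp htwo).mul
    (tendsto_boundedGenFunB.comp (tendsto_id.const_mul_atTop' (by norm_num : 0 < 8)))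
  refine tendsto_nhds_unique hlhs (hprod.congr fun m => ?_)
  rw [show q ^ 6 = (q ^ 3) ^ 2 by ring]
  exact (prod_mul_boundedGenFunB m).symm

end P3Partition

theorem mainTheorem4 :
    A3GenFun =
      QAD.qPoch (-(QAD.a * QAD.q ^ 2)) (QAD.q ^ 6) *
        QAD.qPoch (-(QAD.d * QAD.q ^ 4)) (QAD.q ^ 6) *
        QAD.qPoch (-QAD.q ^ 3) (QAD.q ^ 3) *
        (QAD.qPoch (QAD.q ^ 3) (QAD.q ^ 3))⁻¹ ∧
    ∀ n k m : ℕ, A3 n k m = B3 n k m := by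
  have hA := P3Partition.qPoch_mul_genFunA
  have hconst : MvPowerSeries.constantCoeff (QAD.qPoch (QAD.q ^ 3) (QAD.q ^ 3)) ≠ 0 := by
    have hq := P3Partition.constantCoeff_q_pow three_ne_zero
    rw [QAD.constantCoeff_qPoch hq hq]
    exact one_ne_zero
  constructor
  · rw [MvPowerSeries.eq_mul_inv_iff_mul_eq hconst, ← hA, mul_comm]
    congr 1
    ext e
    exact (P3Partition.coeff_genFunA_univ e).symm
  · intro n k m
    have hne : QAD.qPoch (QAD.q ^ 3) (QAD.q ^ 3) ≠ 0 := fun h => hconst (by rw [h, map_zero])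
    have hAB := mul_left_cancel₀ hne (hA.trans P3Partition.qPoch_mul_genFunB.symm)
    let e : Fin 3 →₀ ℕ := Finsupp.single 0 n + Finsupp.single 1 k + Finsupp.single 2 m
    have hcard : (A3 (e 0) (e 1) (e 2) : ℚ) = B3 (e 0) (e 1) (e 2) := by
      rw [← P3Partition.coeff_genFunA_univ, ← P3Partition.coeff_genFunB_letterB, hAB]
    simpa [e] using hcard
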